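/- Let $\mu$ be an infinitely divisible probability measure on $\mathbb{R}$ all of whose moments $\mu_m=\int x^m\,d\mu(x)$ ($m\ge 0$) exist. For real $t\ge 0$ and an integer $n\ge 1$ define the Maxwell--Boltzmann moment $$\mu^{\circ t}_n=\sum_{j=1}^{n}C^t_j\sum_{\substack{1\le n_1,\dots,n_j\le n\\ n_1+\cdots+n_j=n}}\frac{n!}{n_1!\cdots n_j!}\prod_{i=1}^{j}\mu_{n_i},\qquad C^t_j=\frac{t(t-1)\cdots(t-j+1)}{j!}.$$ (1) For every real $t\ge 0$ there is exactly one probability measure $\rho_t$ on $\mathbb{R}$ with characteristic function $\theta\mapsto e^{t\psi(\theta)}$, where $\psi:\mathbb{R}\to\mathbb{C}$ is the continuous function with $\psi(0)=0$ and $\int e^{i\theta x}\,d\mu(x)=e^{\psi(\theta)}$ for all $\theta$. All moments of $\rho_t$ exist, and $\int x^n\,d\rho_t(x)=\mu^{\circ t}_n$ for every $n\ge 1$. (2) Let $(Y_t)_{t\ge 0}$ be any real L\'evy process (that is, $Y_0=0$ almost surely, with independent and stationary increments and stochastic continuity) such that $Y_1$ has law $\mu$. Then for every real $t\ge 0$ and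 every $n\ge 1$ the moment $E[(Y_t)^n]$ exists and $$E[(Y_t)^n]=\mu^{\circ t}_n .$$ -/

import Mathlib

open MeasureTheory ProbabilityTheory Filter Topology
open scoped NNReal Nat

noncomputable section

/-- The `k`-fold convolution power `ν * ⋯ * ν` (with the unit mass at `0` for `k = 0`). -/
def convPower (ν : Measure ℝ) : ℕ → Measure ℝ
  | 0 => Measure.dirac 0
  | k + 1 => (convPower ν k).conv ν

/-- `μ` is infinitely divisible: for every `k ≥ 1` it is the `k`-fold convolution power of some
probability measure. -/
def IsInfinitelyDivisible (μ : Measure ℝ) : Prop :=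
  ∀ k : ℕ, 1 ≤ k → ∃ ν : Measure ℝ, IsProbabilityMeasure ν ∧ convPower ν k = μ

/-- The Maxwell–Boltzmann moment of index `t` and order `n ≥ 1` attached to a measure `μ`:
`∑_{j=1}^n C(t,j) ∑_{n₁=1}^n ⋯ ∑_{n_j=1}^n 1_{n₁+⋯+n_j = n} n!/(n₁!⋯n_j!) ∏_i μ_{n_i}`,
where `μ_m = ∫ x^m dμ` and `C(t,j) = t(t-1)⋯(t-j+1)/j!`. -/
def maxwellBoltzmann (μ : Measure ℝ) (t : ℝ) (n : ℕ) : ℝ :=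
  ∑ j ∈ Finset.Icc 1 n, Ring.choose t j *
    ∑ m ∈ Fintype.piFinset (fun _ : Fin j => Finset.Icc 1 n),
      if ∑ i, m i = n then
        ((n ! : ℝ) / ∏ i, ((m i)! : ℝ)) * ∏ i, ∫ x, x ^ (m i) ∂μ
      else 0

/-- `ψ` is the characteristic exponent of `μ`: the continuous function with `ψ 0 = 0` and
`∫ e^{iθx} dμ(x) = e^{ψ(θ)}` for all real `θ`. -/
structure IsCharExponent (μ : Measure ℝ) (ψ : ℝ → ℂ) : Prop where
  continuous : Continuous ψ
  map_zero : ψ 0 = 0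
  charFun_eq : ∀ θ : ℝ, charFun μ θ = Complex.exp (ψ θ)

/-- `ρ` is the law at time `t` attached to `μ`: its characteristic function is `e^{t ψ(θ)}`, where
`ψ` is the characteristic exponent of `μ`. -/
def IsLawAtTime (μ : Measure ℝ) (t : ℝ≥0) (ρ : Measure ℝ) : Prop :=
  ∃ ψ : ℝ → ℂ, IsCharExponent μ ψ ∧
    ∀ θ : ℝ, charFun ρ θ = Complex.exp (((t : ℝ) : ℂ) * ψ θ)

/-- A real Lévy process `(X_t)_{t ≥ 0}` (in law: no regularity of the paths is required beyond
stochastic continuity). -/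
structure IsLevyProcess {Ω : Type*} [MeasurableSpace Ω] (P : Measure Ω) (X : ℝ≥0 → Ω → ℝ) :
    Prop where
  measurable : ∀ t, Measurable (X t)
  start_zero : ∀ᵐ ω ∂P, X 0 ω = 0
  indep_increments : HasIndepIncrements X P
  stationary_increments : ∀ s t : ℝ≥0,
    IdentDistrib (fun ω => X (s + t) ω - X s ω) (fun ω => X t ω - X 0 ω) P P
  stochastic_continuity : ∀ s : ℝ≥0, TendstoInMeasure P X (𝓝 s) (X s)

/-- The `n`-th moments of `ρ`, `n ≥ 1`, all exist and are the Maxwell–Boltzmann moments of index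
`t` of `μ`. -/
def HasMaxwellBoltzmannMoments (ρ μ : Measure ℝ) (t : ℝ) : Prop :=
  ∀ n : ℕ, 1 ≤ n → Integrable (fun x : ℝ => x ^ n) ρ ∧ ∫ x, x ^ n ∂ρ = maxwellBoltzmann μ t n

end

/-! Infinite divisibility makes the characteristic function of `μ` zero-free and the moments make it
smooth, so it is `exp ψ` with `ψ` smooth. The moments of `ρ_t` are then the derivatives at `0` of
`exp (tψ)`, up to powers of `I`. Each derivative is a polynomial in `t`. For `t = N` a natural
number it is read off from `F ^ N = (1 + (F - 1)) ^ N`, with `F` the Taylor series of `exp ψ`, which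
gives the Maxwell–Boltzmann sum. That sum is also polynomial in `t`, so the two agree for all `t`
(`iteratedDeriv_cexp_mul_zero`). The law `ρ_t` is a weak limit of convolution powers of roots of
`μ`. It inherits moments because it is a convolution factor of an integer convolution power of `μ`.
The same rational approximation of `t`, with stochastic continuity, identifies the laws of a Lévy
process. -/

/-! ### Derivatives at `0` of `exp (tψ)`. -/

section TaylorSeries

open scoped ContDiff

/-- The Taylor series at `0` of a smooth function. -/
noncomputable def taylorSeries (f : ℝ → ℂ) : PowerSeries ℂ :=
  PowerSeries.mk fun n => iteratedDeriv n f 0 / n !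

lemma coeff_taylorSeries (f : ℝ → ℂ) (n : ℕ) :
    PowerSeries.coeff n (taylorSeries f) = iteratedDeriv n f 0 / n ! := by
  simp [taylorSeries]

lemma taylorSeries_mul {f g : ℝ → ℂ} (hf : ContDiff ℝ ∞ f) (hg : ContDiff ℝ ∞ g) :
    taylorSeries (f * g) = taylorSeries f * taylorSeries g := by
  ext n
  rw [PowerSeries.coeff_mul, coeff_taylorSeries,
    iteratedDeriv_mul (hf.of_le (by exact_mod_cast le_top)).contDiffAt
      (hg.of_le (by exact_mod_cast le_top)).contDiffAt,
    Finset.Nat.sum_antidiagonal_eq_sum_range_succ_mk, Finset.sum_div]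
  refine Finset.sum_congr rfl fun i hi => ?_
  have hi' : i ≤ n := Nat.lt_succ_iff.mp (Finset.mem_range.mp hi)
  rw [coeff_taylorSeries, coeff_taylorSeries, Nat.cast_choose ℂ hi']
  have h1 : ((i ! : ℕ) : ℂ) ≠ 0 := by exact_mod_cast i.factorial_ne_zero
  have h2 : (((n - i)! : ℕ) : ℂ) ≠ 0 := by exact_mod_cast (n - i).factorial_ne_zero
  have h3 : ((n ! : ℕ) : ℂ) ≠ 0 := by exact_mod_cast n.factorial_ne_zero
  field_simp

lemma taylorSeries_one : taylorSeries 1 = 1 := by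
  ext n
  rw [coeff_taylorSeries, PowerSeries.coeff_one]
  rcases n with _ | n
  · simp
  · have : (1 : ℝ → ℂ) = fun _ => 1 := rfl
    simp [this, iteratedDeriv_const]

lemma taylorSeries_pow {f : ℝ → ℂ} (hf : ContDiff ℝ ∞ f) (N : ℕ) :
    taylorSeries (f ^ N) = taylorSeries f ^ N := by
  induction N with
  | zero => simpa using taylorSeries_one
  | succ N ih =>
    rw [pow_succ, pow_succ, ← ih]
    exact taylorSeries_mul (hf.pow N) hf

/-- The coefficients of a power of a power series without constant term, as a sum over
compositions. -/
lemma coeff_pow_eq_sum_piFinset {G F : PowerSeries ℂ} (h0 : PowerSeries.coeff 0 G = 0)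
    (hG : ∀ m, m ≠ 0 → PowerSeries.coeff m G = PowerSeries.coeff m F) (j n : ℕ) :
    PowerSeries.coeff n (G ^ j) =
      ∑ m ∈ Fintype.piFinset (fun _ : Fin j => Finset.Icc 1 n),
        if ∑ i, m i = n then ∏ i, PowerSeries.coeff (m i) F else 0 := by
  have hprod : G ^ j = ∏ _i : Fin j, G := by simp
  rw [hprod, PowerSeries.coeff_prod, ← Finset.sum_filter]
  symm
  -- Tuples with a zero part contribute nothing because `G` has no constant term.
  refine Finset.sum_bij_ne_zero (fun m _ _ => Finsupp.equivFunOnFinite.symm m) ?_ ?_ ?_ ?_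
  · intro m hm _
    simp only [Finset.mem_filter] at hm
    simp [Finset.mem_finsuppAntidiag, hm.2]
  · intro a _ _ b _ _ hab
    exact Finsupp.equivFunOnFinite.symm.injective hab
  · intro l hl hne
    have hpos : ∀ i, 1 ≤ l i := by
      intro i
      by_contra hi
      have hz : l i = 0 := by omega
      exact hne (Finset.prod_eq_zero (Finset.mem_univ i) (by rw [hz, h0]))
    have hsum : ∑ i, l i = n := by simpa [Finset.mem_finsuppAntidiag] using hl
    have hle : ∀ i, l i ≤ n := fun i => by
      rw [← hsum]
      exact Finset.single_le_sum (f := fun i => l i) (fun _ _ => Nat.zero_le _) (Finset.mem_univ i)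
    refine ⟨l, ?_, ?_, by simp⟩
    · simp [Fintype.mem_piFinset, hpos, hle, hsum]
    · rw [Finset.prod_congr rfl fun i _ => (hG (l i) (by have := hpos i; omega)).symm]
      exact hne
  · intro m hm _
    simp only [Finset.mem_filter, Fintype.mem_piFinset, Finset.mem_Icc] at hm
    refine Finset.prod_congr rfl fun i _ => ?_
    rw [hG _ (by have := (hm.1 i).1; simpa using by omega)]
    simp

/-- Binomial expansion of the coefficients of a power of a power series with constant term `1`. -/
lemma coeff_pow_eq_sum_choose {F : PowerSeries ℂ} (h1 : PowerSeries.coeff 0 F = 1) (N : ℕ)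
    {n : ℕ} (hn : 1 ≤ n) :
    PowerSeries.coeff n (F ^ N) =
      ∑ j ∈ Finset.Icc 1 n, (N.choose j : ℂ) *
        ∑ m ∈ Fintype.piFinset (fun _ : Fin j => Finset.Icc 1 n),
          if ∑ i, m i = n then ∏ i, PowerSeries.coeff (m i) F else 0 := by
  have h0 : PowerSeries.coeff 0 (F - 1) = 0 := by rw [map_sub, h1]; simp
  have hG : ∀ m, m ≠ 0 → PowerSeries.coeff m (F - 1) = PowerSeries.coeff m F := by
    intro m hm
    simp [PowerSeries.coeff_one, hm]
  have hvan : ∀ j, n < j → PowerSeries.coeff n ((F - 1) ^ j) = 0 := by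
    intro j hj
    have hX : (PowerSeries.X : PowerSeries ℂ) ∣ F - 1 := by
      rw [PowerSeries.X_dvd_iff, ← PowerSeries.coeff_zero_eq_constantCoeff_apply, h0]
    exact PowerSeries.X_pow_dvd_iff.mp (pow_dvd_pow_of_dvd hX j) n hj
  have hF : F = (F - 1) + 1 := by ring
  have hexp : PowerSeries.coeff n (F ^ N) =
      ∑ j ∈ Finset.range (N + 1), (N.choose j : ℂ) * PowerSeries.coeff n ((F - 1) ^ j) := by
    conv_lhs => rw [hF, add_pow]
    rw [map_sum]
    refine Finset.sum_congr rfl fun j _ => ?_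
    rw [one_pow, mul_one, ← map_natCast (PowerSeries.C (R := ℂ)), mul_comm,
      PowerSeries.coeff_C_mul]
  rw [hexp, Finset.sum_congr rfl fun j (_ : j ∈ Finset.Icc 1 n) => by
    rw [← coeff_pow_eq_sum_piFinset h0 hG j n]]
  -- Both sums extend to a common range: terms with `j > N`, `j > n` or `j = 0` vanish, the last
  -- because `n ≥ 1`.
  have hA : Finset.range (N + 1) ⊆ Finset.range (N + n + 1) :=
    Finset.range_subset_range.mpr (by omega)
  have hB : Finset.Icc 1 n ⊆ Finset.range (N + n + 1) := by
    intro j hj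
    simp only [Finset.mem_Icc, Finset.mem_range] at *
    omega
  rw [Finset.sum_subset hA, Finset.sum_subset hB]
  · intro j _ hj
    rcases Nat.eq_zero_or_pos j with rfl | hpos
    · rw [pow_zero, PowerSeries.coeff_one, if_neg (by omega), mul_zero]
    · rw [hvan j (by simp only [Finset.mem_Icc] at hj; omega), mul_zero]
  · intro j _ hj
    rw [Nat.choose_eq_zero_of_lt (by simpa using hj)]
    simp

lemma deriv_cexp_mul {ψ : ℝ → ℂ} (hψ : ContDiff ℝ ∞ ψ) (t : ℂ) :
    deriv (fun θ => Complex.exp (t * ψ θ)) =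
      fun θ => (t * deriv ψ θ) * Complex.exp (t * ψ θ) := by
  funext θ
  have h : HasDerivAt ψ (deriv ψ θ) θ := (hψ.differentiable (by simp) θ).hasDerivAt
  rw [((h.const_mul t).cexp).deriv, mul_comm]

lemma contDiff_cexp_mul {ψ : ℝ → ℂ} (hψ : ContDiff ℝ ∞ ψ) (t : ℂ) :
    ContDiff ℝ ∞ (fun θ => Complex.exp (t * ψ θ)) :=
  (contDiff_const.mul hψ).cexp

/-- The derivatives at `0` of `exp (t ψ)` are polynomials in `t`. -/
lemma exists_polynomial_iteratedDeriv_cexp_mul {ψ : ℝ → ℂ} (hψ : ContDiff ℝ ∞ ψ) (h0 : ψ 0 = 0)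
    (n : ℕ) : ∃ p : Polynomial ℂ, ∀ t : ℂ,
      iteratedDeriv n (fun θ => Complex.exp (t * ψ θ)) 0 = p.eval t := by
  induction n using Nat.strong_induction_on with
  | _ n ih =>
    rcases n with _ | n
    · exact ⟨1, fun t => by simp [h0]⟩
    · choose! p hp using ih
      -- Leibniz rule applied to `(exp (tψ))' = tψ' exp (tψ)`.
      refine ⟨∑ i ∈ Finset.range (n + 1),
        Polynomial.C (n.choose i * iteratedDeriv i (deriv ψ) 0) * Polynomial.X * p (n - i),
        fun t => ?_⟩
      have hd : ContDiff ℝ ∞ (deriv ψ) := (contDiff_infty_iff_deriv.mp hψ).2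
      rw [iteratedDeriv_succ', deriv_cexp_mul hψ]
      have hmul := iteratedDeriv_mul (n := n) (x := (0 : ℝ)) (f := fun θ => t * deriv ψ θ)
        (g := fun θ => Complex.exp (t * ψ θ))
        (((contDiff_const.mul hd).of_le (by exact_mod_cast le_top)).contDiffAt)
        (((contDiff_cexp_mul hψ t).of_le (by exact_mod_cast le_top)).contDiffAt)
      refine hmul.trans ?_
      rw [Polynomial.eval_finsetSum]
      refine Finset.sum_congr rfl fun i hi => ?_
      rw [hp (n - i) (by omega) t, iteratedDeriv_const_mul_field]
      simp only [Polynomial.eval_mul, Polynomial.eval_C, Polynomial.eval_X]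
      ring

/-- The binomial coefficient `C(t, j)` is a polynomial in `t`. -/
lemma exists_polynomial_ringChoose (j : ℕ) :
    ∃ p : Polynomial ℂ, ∀ t : ℂ, Ring.choose t j = p.eval t := by
  refine ⟨Polynomial.C ((j ! : ℂ)⁻¹) * (descPochhammer ℤ j).map (algebraMap ℤ ℂ), fun t => ?_⟩
  rw [Ring.choose_eq_smul, ← Polynomial.aeval_eq_smeval, Polynomial.eval_mul, Polynomial.eval_C,
    Polynomial.eval_map_algebraMap, smul_eq_mul]

/-- The derivatives at `0` of `exp (t ψ)`, in terms of those of `exp ψ`. -/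
theorem iteratedDeriv_cexp_mul_zero {ψ : ℝ → ℂ} (hψ : ContDiff ℝ ∞ ψ) (h0 : ψ 0 = 0) (t : ℂ)
    {n : ℕ} (hn : 1 ≤ n) :
    iteratedDeriv n (fun θ => Complex.exp (t * ψ θ)) 0 =
      ∑ j ∈ Finset.Icc 1 n, Ring.choose t j *
        ∑ m ∈ Fintype.piFinset (fun _ : Fin j => Finset.Icc 1 n),
          if ∑ i, m i = n then
            ((n ! : ℂ) / ∏ i, ((m i)! : ℂ)) *
              ∏ i, iteratedDeriv (m i) (fun θ => Complex.exp (ψ θ)) 0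
          else 0 := by
  obtain ⟨p, hp⟩ := exists_polynomial_iteratedDeriv_cexp_mul hψ h0 n
  choose c hc using exists_polynomial_ringChoose
  set A : ℕ → ℂ := fun j => ∑ m ∈ Fintype.piFinset (fun _ : Fin j => Finset.Icc 1 n),
          if ∑ i, m i = n then
            ((n ! : ℂ) / ∏ i, ((m i)! : ℂ)) *
              ∏ i, iteratedDeriv (m i) (fun θ => Complex.exp (ψ θ)) 0
          else 0 with hA
  have hpq : p = ∑ j ∈ Finset.Icc 1 n, c j * Polynomial.C (A j) := by
    -- It suffices to compare at natural numbers.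
    refine Polynomial.eq_of_infinite_eval_eq _ _ ?_
    refine (Set.infinite_range_of_injective (Nat.cast_injective (R := ℂ))).mono ?_
    rintro _ ⟨N, rfl⟩
    have hsm : ContDiff ℝ ∞ (fun θ => Complex.exp (ψ θ)) := hψ.cexp
    have hpow : (fun θ => Complex.exp ((N : ℂ) * ψ θ)) = (fun θ => Complex.exp (ψ θ)) ^ N := by
      funext θ
      simp [Complex.exp_nat_mul]
    have h1 : PowerSeries.coeff 0 (taylorSeries fun θ => Complex.exp (ψ θ)) = 1 := by
      simp [coeff_taylorSeries, h0]
    have hnf : (n ! : ℂ) ≠ 0 := by exact_mod_cast n.factorial_ne_zero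
    have key := coeff_pow_eq_sum_choose h1 N hn
    rw [← taylorSeries_pow hsm, ← hpow, coeff_taylorSeries, div_eq_iff hnf] at key
    simp only [Set.mem_ofPred_eq, Polynomial.eval_finsetSum, Polynomial.eval_mul, Polynomial.eval_C]
    rw [← hp, key, Finset.sum_mul]
    refine Finset.sum_congr rfl fun j _ => ?_
    rw [← hc, Ring.choose_natCast, mul_assoc, hA, Finset.sum_mul]
    refine congrArg _ (Finset.sum_congr rfl fun m _ => ?_)
    split_ifs
    · simp only [coeff_taylorSeries, Finset.prod_div_distrib]
      ring
    · simp
  rw [hp, hpq]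
  simp [Polynomial.eval_finsetSum, hc, hA]

end TaylorSeries

/-! ### Convolution powers and moments. -/

section Convolution

instance isProbabilityMeasure_convPower (ν : Measure ℝ) [IsProbabilityMeasure ν] (k : ℕ) :
    IsProbabilityMeasure (convPower ν k) := by
  induction k with
  | zero => rw [convPower]; infer_instance
  | succ k ih => rw [convPower]; infer_instance

lemma charFun_convPower (ν : Measure ℝ) [IsProbabilityMeasure ν] (k : ℕ) (θ : ℝ) :
    charFun (convPower ν k) θ = charFun ν θ ^ k := by
  induction k with
  | zero => simp [convPower, charFun_dirac]
  | succ k ih => rw [convPower, charFun_conv, ih, pow_succ]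

lemma memLp_id_of_integrable_pow {μ : Measure ℝ} [IsFiniteMeasure μ]
    (h : ∀ n : ℕ, Integrable (fun x : ℝ => x ^ n) μ) (n : ℕ) : MemLp id n μ := by
  rcases Nat.eq_zero_or_pos n with rfl | hn
  · simpa using aestronglyMeasurable_id
  · rw [← integrable_norm_rpow_iff aestronglyMeasurable_id (by exact_mod_cast hn.ne') (by simp)]
    simpa using (h n).norm

lemma integrable_pow_of_memLp_id {μ : Measure ℝ} [IsFiniteMeasure μ] {n : ℕ}
    (h : MemLp id n μ) : Integrable (fun x : ℝ => x ^ n) μ := by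
  refine (integrable_norm_iff (by fun_prop)).mp ?_
  simpa using h.integrable_norm_pow'

lemma memLp_id_conv {μ ν : Measure ℝ} [IsProbabilityMeasure μ] [IsProbabilityMeasure ν] {n : ℕ}
    (hμ : MemLp id n μ) (hν : MemLp id n ν) : MemLp id n (μ.conv ν) := by
  rw [Measure.conv, memLp_map_measure_iff aestronglyMeasurable_id (by fun_prop)]
  exact (hμ.comp_fst ν).add (hν.comp_snd μ)

lemma memLp_id_convPower {ν : Measure ℝ} [IsProbabilityMeasure ν] {n : ℕ}
    (hν : MemLp id n ν) (k : ℕ) : MemLp id n (convPower ν k) := by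
  induction k with
  | zero =>
    rw [convPower]
    exact (memLp_const (0 : ℝ)).ae_eq (by simp [Filter.EventuallyEq, ae_dirac_eq])
  | succ k ih => rw [convPower]; exact memLp_id_conv ih hν

/-- If a convolution has a moment of order `n`, then so does its left factor. -/
lemma memLp_id_of_conv {μ ν : Measure ℝ} [IsProbabilityMeasure μ] [IsProbabilityMeasure ν] {n : ℕ}
    (h : MemLp id n (μ.conv ν)) : MemLp id n μ := by
  rcases Nat.eq_zero_or_pos n with rfl | hn
  · simpa using aestronglyMeasurable_id
  have hn0 : (n : ENNReal) ≠ 0 := by exact_mod_cast hn.ne'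
  rw [Measure.conv, memLp_map_measure_iff aestronglyMeasurable_id (by fun_prop)] at h
  have hint := (integrable_prod_iff' (by fun_prop)).mp (h.integrable_norm_pow hn.ne')
  -- By Fubini almost every translate has the moment; one translate suffices.
  obtain ⟨y, hy⟩ := hint.1.exists
  have hadd : MemLp (fun x : ℝ => x + y) n μ := by
    rw [← integrable_norm_rpow_iff (by fun_prop) hn0 (by simp)]
    simpa using hy
  have := hadd.sub (memLp_const y)
  exact this.ae_eq (by filter_upwards with x; simp)

end Convolution

/-! ### Absence of zeros. -/

section Nonvanishing

lemma re_charFun (σ : Measure ℝ) [IsProbabilityMeasure σ] (θ : ℝ) :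
    (charFun σ θ).re = ∫ x, Real.cos (θ * x) ∂σ := by
  rw [charFun_apply_real, ← RCLike.re_eq_complex_re, ← integral_re]
  · refine integral_congr_ae (ae_of_all _ fun x => ?_)
    have : (θ : ℂ) * x * Complex.I = ((θ * x : ℝ) : ℂ) * Complex.I := by push_cast; ring
    simp only [this, RCLike.re_eq_complex_re, Complex.exp_ofReal_mul_I_re]
  · refine (integrable_const (1 : ℝ)).mono (by fun_prop) (ae_of_all _ fun x => ?_)
    have : (θ : ℂ) * x * Complex.I = ((θ * x : ℝ) : ℂ) * Complex.I := by push_cast; ring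
    rw [this, Complex.norm_exp_ofReal_mul_I]
    simp

/-- Integrates `1 - cos 2a ≤ 4 (1 - cos a)`, which amounts to `(1 - cos a)² ≥ 0`. -/
lemma one_sub_re_charFun_two_mul_le (σ : Measure ℝ) [IsProbabilityMeasure σ] (θ : ℝ) :
    1 - (charFun σ (2 * θ)).re ≤ 4 * (1 - (charFun σ θ).re) := by
  have hcos : ∀ a : ℝ, Integrable (fun x => Real.cos (a * x)) σ := fun a =>
    (integrable_const (1 : ℝ)).mono (by fun_prop)
      (ae_of_all _ fun x => by simpa using Real.abs_cos_le_one (a * x))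
  have h1 : ∀ a : ℝ, 1 - ∫ x, Real.cos (a * x) ∂σ = ∫ x, (1 - Real.cos (a * x)) ∂σ := fun a => by
    rw [integral_sub (integrable_const _) (hcos a)]
    simp
  rw [re_charFun, re_charFun, h1, h1, ← integral_const_mul]
  refine integral_mono ((integrable_const _).sub (hcos _))
    (((integrable_const _).sub (hcos _)).const_mul 4) fun x => ?_
  have : Real.cos (2 * θ * x) = 2 * Real.cos (θ * x) ^ 2 - 1 := by
    rw [mul_assoc, Real.cos_two_mul]
  simp only [this]
  nlinarith [sq_nonneg (1 - Real.cos (θ * x))]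

/-- Symmetrization: convolving `ν` with its reflection replaces the characteristic function by its
squared modulus. -/
lemma one_sub_sq_norm_charFun_two_mul_le (ν : Measure ℝ) [IsProbabilityMeasure ν] (θ : ℝ) :
    1 - ‖charFun ν (2 * θ)‖ ^ 2 ≤ 4 * (1 - ‖charFun ν θ‖ ^ 2) := by
  have : IsProbabilityMeasure (ν.map (fun x => (-1 : ℝ) * x)) :=
    Measure.isProbabilityMeasure_map (by fun_prop)
  have h : ∀ a : ℝ, (charFun (ν.conv (ν.map (fun x => (-1 : ℝ) * x))) a).re
      = ‖charFun ν a‖ ^ 2 := fun a => by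
    rw [charFun_conv, charFun_map_mul, neg_one_mul, charFun_neg, Complex.mul_conj,
      Complex.normSq_eq_norm_sq, Complex.ofReal_re]
  simpa only [h] using one_sub_re_charFun_two_mul_le (ν.conv (ν.map (fun x => (-1 : ℝ) * x))) θ

/-- At `θ`, a root of high order has squared modulus above `3/4 = 1 - 1/4`, so the doubling
inequality keeps it positive at `2θ`. -/
lemma IsInfinitelyDivisible.charFun_two_mul_ne_zero {μ : Measure ℝ} (hdiv : IsInfinitelyDivisible μ)
    {θ : ℝ} (h : charFun μ θ ≠ 0) : charFun μ (2 * θ) ≠ 0 := by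
  obtain ⟨k, hk⟩ := exists_pow_lt_of_lt_one (y := (3 / 4 : ℝ)) (x := ‖charFun μ θ‖ ^ 2)
    (by positivity) (by norm_num)
  have hk' : (3 / 4 : ℝ) ^ (k + 1) < ‖charFun μ θ‖ ^ 2 :=
    lt_of_le_of_lt (pow_le_pow_of_le_one (by norm_num) (by norm_num) k.le_succ) hk
  obtain ⟨ν, hν, rfl⟩ := hdiv (k + 1) (by omega)
  rw [charFun_convPower]
  rw [charFun_convPower, norm_pow, ← pow_mul, mul_comm, pow_mul] at hk'
  have h34 := lt_of_pow_lt_pow_left₀ (k + 1) (by positivity) hk'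
  have := one_sub_sq_norm_charFun_two_mul_le ν θ
  refine pow_ne_zero _ fun h0 => ?_
  rw [h0] at this
  norm_num at this
  linarith

/-- The characteristic function of an infinitely divisible law has no zeros. -/
theorem IsInfinitelyDivisible.charFun_ne_zero {μ : Measure ℝ} [IsProbabilityMeasure μ]
    (hdiv : IsInfinitelyDivisible μ) (θ : ℝ) : charFun μ θ ≠ 0 := by
  have hdouble : ∀ m : ℕ, ∀ θ : ℝ, charFun μ (θ * (1 / 2) ^ m) ≠ 0 → charFun μ θ ≠ 0 := by
    intro m
    induction m with
    | zero => simp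
    | succ m ih =>
      intro θ h
      refine ih θ ?_
      have := hdiv.charFun_two_mul_ne_zero h
      rwa [show 2 * (θ * (1 / 2) ^ (m + 1)) = θ * (1 / 2 : ℝ) ^ m by ring] at this
  have hlim : Tendsto (fun m : ℕ => θ * (1 / 2 : ℝ) ^ m) atTop (𝓝 0) := by
    simpa using (tendsto_pow_atTop_nhds_zero_of_lt_one (r := (1 / 2 : ℝ)) (by norm_num)
      (by norm_num)).const_mul θ
  have hcont : Tendsto (fun m : ℕ => charFun μ (θ * (1 / 2 : ℝ) ^ m)) atTop (𝓝 1) := by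
    have := (continuous_charFun (μ := μ)).tendsto 0 |>.comp hlim
    simpa [Function.comp_def] using this
  obtain ⟨m, hm⟩ := (hcont.eventually_ne one_ne_zero).exists
  exact hdouble m θ hm

end Nonvanishing

/-! ### The characteristic exponent. -/

section Exponent

open scoped ContDiff

/-- Two lifts through the covering map `exp` that agree at `0` coincide. -/
lemma IsCharExponent.unique {μ : Measure ℝ} {ψ₁ ψ₂ : ℝ → ℂ} (h₁ : IsCharExponent μ ψ₁)
    (h₂ : IsCharExponent μ ψ₂) : ψ₁ = ψ₂ := by
  refine Complex.isCoveringMap_exp.eq_of_comp_eq h₁.continuous h₂.continuous ?_ 0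
    (by rw [h₁.map_zero, h₂.map_zero])
  funext θ
  simp [← h₁.charFun_eq, ← h₂.charFun_eq]

/-- Integrate the logarithmic derivative. -/
lemma exists_contDiff_isCharExponent {μ : Measure ℝ} [IsProbabilityMeasure μ]
    (hne : ∀ θ, charFun μ θ ≠ 0) (hsm : ContDiff ℝ ∞ (charFun μ)) :
    ∃ ψ : ℝ → ℂ, IsCharExponent μ ψ ∧ ContDiff ℝ ∞ ψ := by
  set f := charFun μ with hf
  have hq : ContDiff ℝ ∞ (fun θ => deriv f θ * (f θ)⁻¹) :=
    (contDiff_infty_iff_deriv.mp hsm).2.mul (hsm.inv hne)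
  set ψ : ℝ → ℂ := fun θ => ∫ s in (0 : ℝ)..θ, deriv f s * (f s)⁻¹ with hψ
  have hder : ∀ θ, HasDerivAt ψ (deriv f θ * (f θ)⁻¹) θ := fun θ =>
    hq.continuous.integral_hasStrictDerivAt 0 θ |>.hasDerivAt
  have hdψ : deriv ψ = fun θ => deriv f θ * (f θ)⁻¹ := funext fun θ => (hder θ).deriv
  have hsψ : ContDiff ℝ ∞ ψ :=
    contDiff_infty_iff_deriv.mpr ⟨fun θ => (hder θ).differentiableAt, hdψ ▸ hq⟩
  have h0 : ψ 0 = 0 := by simp [hψ]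
  refine ⟨ψ, ⟨hsψ.continuous, h0, fun θ => ?_⟩, hsψ⟩
  have hprod : ∀ s, HasDerivAt (fun s => f s * Complex.exp (-ψ s)) 0 s := fun s => by
    have h1 : HasDerivAt f (deriv f s) s := (hsm.differentiable (by simp) s).hasDerivAt
    convert! h1.mul (hder s).neg.cexp using 1
    field_simp [hne s]
    ring
  have hconst := is_const_of_deriv_eq_zero (fun s => (hprod s).differentiableAt)
    (fun s => (hprod s).deriv) θ 0
  simp only [h0, neg_zero, Complex.exp_zero, mul_one, Complex.exp_neg] at hconst
  rw [mul_inv_eq_iff_eq_mul₀ (Complex.exp_ne_zero _)] at hconst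
  simpa [hf] using hconst

/-- The characteristic function of a `k`-th root of `μ` is `exp (ψ / k)`. -/
lemma IsCharExponent.charFun_eq_of_pow_eq {μ ν : Measure ℝ} [IsProbabilityMeasure ν] {ψ : ℝ → ℂ}
    (hψ : IsCharExponent μ ψ) {k : ℕ} (hk : k ≠ 0) (h : ∀ θ, charFun ν θ ^ k = charFun μ θ)
    (θ : ℝ) : charFun ν θ = Complex.exp (ψ θ / k) := by
  have hkC : (k : ℂ) ≠ 0 := by exact_mod_cast hk
  set g : ℝ → ℂ := fun θ => charFun ν θ * Complex.exp (-(ψ θ / k)) with hg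
  have hgc : Continuous g :=
    continuous_charFun.mul (Complex.continuous_exp.comp (hψ.continuous.div_const _).neg)
  have hgk : ∀ s, g s ^ k = 1 := fun s => by
    rw [hg, mul_pow, h, hψ.charFun_eq, ← Complex.exp_nat_mul, ← Complex.exp_add]
    rw [show ψ s + k * -(ψ s / k) = 0 by field_simp; ring, Complex.exp_zero]
  have hfin : {z : ℂ | z ^ k = 1}.Finite := by
    refine (Polynomial.nthRoots k (1 : ℂ)).toFinset.finite_toSet.subset fun z hz => ?_
    simpa [Polynomial.mem_nthRoots (Nat.pos_of_ne_zero hk)] using hz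
  -- A connected set of `k`-th roots of unity is a single point.
  have hsub : (Set.range g).Subsingleton :=
    hfin.countable.isTotallyDisconnected _ (by rintro _ ⟨s, rfl⟩; exact hgk s)
      (isPreconnected_range hgc)
  have h1 : g θ = g 0 := hsub ⟨θ, rfl⟩ ⟨0, rfl⟩
  have h0 : g 0 = 1 := by simp [hg, hψ.map_zero]
  rw [h0] at h1
  simp only [hg, Complex.exp_neg] at h1
  simpa using (mul_inv_eq_iff_eq_mul₀ (Complex.exp_ne_zero _)).mp h1

end Exponent

/-! ### Existence and moments of `ρ_t`. -/

section LawAtTime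

open scoped ContDiff

/-- A pointwise limit of characteristic functions that is continuous at `0` is a characteristic
function. -/
lemma exists_charFun_eq_of_tendsto {ν : ℕ → ProbabilityMeasure ℝ} {f : ℝ → ℂ}
    (hf : ContinuousAt f 0)
    (h : ∀ θ, Tendsto (fun n => charFun (ν n : Measure ℝ) θ) atTop (𝓝 (f θ))) :
    ∃ ρ : ProbabilityMeasure ℝ, ∀ θ, charFun (ρ : Measure ℝ) θ = f θ := by
  -- Continuity at `0` gives tightness, and Prokhorov's theorem a convergent subsequence.
  have htight := isTightMeasureSet_of_tendsto_charFun (μ := fun n => (ν n : Measure ℝ)) hf h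
  have hcomp : IsCompact (closure (Set.range ν)) := by
    refine isCompact_closure_of_isTightMeasureSet ?_
    convert htight using 1
    ext σ
    simp
  obtain ⟨ρ, -, u, hu, hlim⟩ :=
    hcomp.tendsto_subseq fun n => subset_closure (Set.mem_range_self n)
  refine ⟨ρ, fun θ => ?_⟩
  have h1 := ProbabilityMeasure.tendsto_iff_tendsto_charFun.mp hlim θ
  exact tendsto_nhds_unique h1 ((h θ).comp hu.tendsto_atTop)

lemma tendsto_floor_mul_div (t : ℝ≥0) :
    Tendsto (fun n : ℕ => ((⌊(t : ℝ) * ((n + 1 : ℕ) : ℝ)⌋₊ : ℝ≥0) / ((n + 1 : ℕ) : ℝ≥0)))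
      atTop (𝓝 t) := by
  rw [← NNReal.tendsto_coe]
  have h := (tendsto_nat_floor_mul_div_atTop (R := ℝ) t.coe_nonneg).comp
    (tendsto_natCast_atTop_atTop.comp (tendsto_add_atTop_nat 1))
  refine h.congr fun n => ?_
  simp

lemma tendsto_cexp_floor_mul_div (t : ℝ≥0) (z : ℂ) :
    Tendsto (fun n : ℕ => Complex.exp (z / ((n + 1 : ℕ) : ℂ)) ^ ⌊(t : ℝ) * ((n + 1 : ℕ) : ℝ)⌋₊)
      atTop (𝓝 (Complex.exp (((t : ℝ) : ℂ) * z))) := by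
  have h1 := (Complex.continuous_ofReal.comp NNReal.continuous_coe).tendsto t |>.comp
    (tendsto_floor_mul_div t)
  have h2 := (Complex.continuous_exp.tendsto _).comp (h1.mul_const z)
  refine h2.congr fun n => ?_
  simp only [Function.comp_apply, ← Complex.exp_nat_mul]
  congr 1
  push_cast
  ring

lemma exists_charFun_eq_cexp_mul {μ : Measure ℝ} (hdiv : IsInfinitelyDivisible μ) {ψ : ℝ → ℂ}
    (hψ : IsCharExponent μ ψ) (t : ℝ≥0) :
    ∃ ρ : ProbabilityMeasure ℝ,
      ∀ θ, charFun (ρ : Measure ℝ) θ = Complex.exp (((t : ℝ) : ℂ) * ψ θ) := by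
  choose ν hν hroot using fun n : ℕ => hdiv (n + 1) (by omega)
  refine exists_charFun_eq_of_tendsto
    (ν := fun n => ⟨convPower (ν n) ⌊(t : ℝ) * ((n + 1 : ℕ) : ℝ)⌋₊, inferInstance⟩) ?_ fun θ => ?_
  · exact (Complex.continuous_exp.comp (continuous_const.mul hψ.continuous)).continuousAt
  · refine (tendsto_cexp_floor_mul_div t (ψ θ)).congr fun n => ?_
    rw [ProbabilityMeasure.coe_mk, charFun_convPower,
      hψ.charFun_eq_of_pow_eq n.succ_ne_zero fun s => by rw [← charFun_convPower, hroot]]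

lemma maxwellBoltzmann_eq_iteratedDeriv {μ : Measure ℝ} [IsProbabilityMeasure μ]
    (hmem : ∀ n : ℕ, MemLp id n μ) {ψ : ℝ → ℂ} (hψ : IsCharExponent μ ψ)
    (hsm : ContDiff ℝ ∞ ψ) (t : ℝ) {n : ℕ} (hn : 1 ≤ n) :
    iteratedDeriv n (fun θ => Complex.exp ((t : ℂ) * ψ θ)) 0 =
      Complex.I ^ n * maxwellBoltzmann μ t n := by
  have hchar : (fun θ => Complex.exp (ψ θ)) = charFun μ :=
    funext fun θ => (hψ.charFun_eq θ).symm
  rw [iteratedDeriv_cexp_mul_zero hsm hψ.map_zero _ hn, hchar, maxwellBoltzmann]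
  push_cast
  rw [Finset.mul_sum]
  refine Finset.sum_congr rfl fun j _ => ?_
  rw [mul_left_comm]
  congr 1
  rw [Finset.mul_sum]
  refine Finset.sum_congr rfl fun m _ => ?_
  split_ifs with hm
  · simp only [iteratedDeriv_charFun_zero (hmem _), Finset.prod_mul_distrib,
      Finset.prod_pow_eq_pow_sum, hm]
    push_cast
    ring
  · simp

lemma IsLawAtTime.memLp_id {μ : Measure ℝ} [IsProbabilityMeasure μ]
    (hdiv : IsInfinitelyDivisible μ) {t : ℝ≥0} {ρ : Measure ℝ}
    [IsProbabilityMeasure ρ] (hρ : IsLawAtTime μ t ρ) {n : ℕ} (hmem : MemLp id n μ) :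
    MemLp id n ρ := by
  obtain ⟨ψ, hψ, hρψ⟩ := hρ
  obtain ⟨N, hN⟩ := exists_nat_ge t
  -- The complementary law `ρ_{N-t}`; the truncated subtraction is exact since `t ≤ N`.
  obtain ⟨σ, hσ⟩ := exists_charFun_eq_cexp_mul hdiv hψ (N - t)
  have hconv : ρ.conv (σ : Measure ℝ) = convPower μ N := by
    refine Measure.ext_of_charFun (funext fun θ => ?_)
    rw [charFun_conv, hρψ, hσ, charFun_convPower, hψ.charFun_eq, ← Complex.exp_add,
      ← Complex.exp_nat_mul, NNReal.coe_sub hN]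
    congr 1
    push_cast
    ring
  exact memLp_id_of_conv (hconv ▸ memLp_id_convPower hmem N)

/-- The law at time `t` has all its moments, and they are the Maxwell–Boltzmann moments. -/
theorem IsLawAtTime.hasMaxwellBoltzmannMoments {μ : Measure ℝ} [IsProbabilityMeasure μ]
    (hdiv : IsInfinitelyDivisible μ) (hmem : ∀ n : ℕ, MemLp id n μ) {t : ℝ≥0} {ρ : Measure ℝ}
    [IsProbabilityMeasure ρ] (hρ : IsLawAtTime μ t ρ) :
    HasMaxwellBoltzmannMoments ρ μ t := by
  intro n hn
  have hρmem := hρ.memLp_id hdiv (hmem n)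
  refine ⟨integrable_pow_of_memLp_id hρmem, ?_⟩
  obtain ⟨ψ, hψ, hsm⟩ := exists_contDiff_isCharExponent hdiv.charFun_ne_zero
    (contDiff_charFun' (n := ⊤) hmem)
  obtain ⟨ψ', hψ', hρψ⟩ := hρ
  obtain rfl := hψ.unique hψ'
  have h1 := iteratedDeriv_charFun_zero hρmem
  rw [show charFun ρ = _ from funext hρψ, maxwellBoltzmann_eq_iteratedDeriv hmem hψ hsm t hn] at h1
  exact_mod_cast (mul_left_cancel₀ (pow_ne_zero n Complex.I_ne_zero) h1).symm

end LawAtTime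

/-! ### Lévy processes. -/

section Levy

variable {Ω : Type*} [MeasurableSpace Ω] {P : Measure Ω} [IsProbabilityMeasure P]
  {X : ℝ≥0 → Ω → ℝ}

lemma IsLevyProcess.charFun_map_add (hX : IsLevyProcess P X) (s t : ℝ≥0) (θ : ℝ) :
    charFun (P.map (X (s + t))) θ = charFun (P.map (X s)) θ * charFun (P.map (X t)) θ := by
  have hindep : IndepFun (X s) (X (s + t) - X s) P :=
    hX.indep_increments.indepFun_eval_sub (r := 0) zero_le le_self_add hX.start_zero
  have hlaw : P.map (X (s + t) - X s) = P.map (X t) := by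
    refine (hX.stationary_increments s t).map_eq.trans (Measure.map_congr ?_)
    filter_upwards [hX.start_zero] with ω hω
    simp [hω]
  have hadd := hindep.charFun_map_add_eq_mul (hX.measurable s).aemeasurable
    ((hX.measurable (s + t)).sub (hX.measurable s)).aemeasurable
  rw [hlaw, add_sub_cancel] at hadd
  exact congrFun hadd θ

lemma IsLevyProcess.charFun_map_nat_mul (hX : IsLevyProcess P X) (k : ℕ) (s : ℝ≥0) (θ : ℝ) :
    charFun (P.map (X (k * s))) θ = charFun (P.map (X s)) θ ^ k := by
  induction k with
  | zero =>
    have h0 : P.map (X 0) = Measure.dirac 0 := by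
      rw [Measure.map_congr (g := fun _ => (0 : ℝ)) hX.start_zero]
      simp
    simp [h0, charFun_dirac]
  | succ k ih => rw [Nat.cast_succ, add_mul, one_mul, hX.charFun_map_add, ih, pow_succ]

/-- The one-dimensional laws of a Lévy process are the laws attached to its law at time `1`. -/
theorem IsLevyProcess.isLawAtTime (hX : IsLevyProcess P X) {ψ : ℝ → ℂ}
    (hψ : IsCharExponent (P.map (X 1)) ψ) (t : ℝ≥0) :
    IsLawAtTime (P.map (X 1)) t (P.map (X t)) := by
  refine ⟨ψ, hψ, fun θ => ?_⟩
  have hprob : ∀ s, IsProbabilityMeasure (P.map (X s)) := fun s =>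
    Measure.isProbabilityMeasure_map (hX.measurable s).aemeasurable
  -- At rational times the law is a power of a root of the law at time `1`.
  have hrat : ∀ n k : ℕ, charFun (P.map (X ((k : ℝ≥0) / ((n + 1 : ℕ) : ℝ≥0)))) θ =
      Complex.exp (ψ θ / ((n + 1 : ℕ) : ℂ)) ^ k := fun n k => by
    rw [div_eq_mul_inv, hX.charFun_map_nat_mul]
    congr 1
    refine hψ.charFun_eq_of_pow_eq n.succ_ne_zero (fun s => ?_) θ
    rw [← hX.charFun_map_nat_mul, mul_inv_cancel₀ (by exact_mod_cast n.succ_ne_zero)]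
  have hmeas : TendstoInMeasure P
      (fun n : ℕ => X ((⌊(t : ℝ) * ((n + 1 : ℕ) : ℝ)⌋₊ : ℝ≥0) / ((n + 1 : ℕ) : ℝ≥0))) atTop (X t) :=
    (hX.stochastic_continuity t).comp (tendsto_floor_mul_div t)
  have hdist := (hmeas.tendstoInDistribution fun n => (hX.measurable _).aemeasurable).tendsto
  have hlim := ProbabilityMeasure.tendsto_iff_tendsto_charFun.mp hdist θ
  simp only [ProbabilityMeasure.coe_mk, hrat] at hlim
  exact tendsto_nhds_unique hlim (tendsto_cexp_floor_mul_div t (ψ θ))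

end Levy

theorem mainTheorem1 (μ : Measure ℝ) [IsProbabilityMeasure μ]
    (hdiv : IsInfinitelyDivisible μ)
    (hmom : ∀ n : ℕ, Integrable (fun x : ℝ => x ^ n) μ) :
    (∀ t : ℝ≥0,
      (∃! ρ : ProbabilityMeasure ℝ, IsLawAtTime μ t (ρ : Measure ℝ)) ∧
      ∀ ρ : ProbabilityMeasure ℝ, IsLawAtTime μ t (ρ : Measure ℝ) →
        HasMaxwellBoltzmannMoments (ρ : Measure ℝ) μ t) ∧
    (∀ (Ω : Type*) [MeasurableSpace Ω] (P : Measure Ω) [IsProbabilityMeasure P]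
      (Y : ℝ≥0 → Ω → ℝ), IsLevyProcess P Y → P.map (Y 1) = μ →
        ∀ t : ℝ≥0, ∀ n : ℕ, 1 ≤ n →
          Integrable (fun ω => Y t ω ^ n) P ∧
            ∫ ω, Y t ω ^ n ∂P = maxwellBoltzmann μ t n) := by
  have hmem := memLp_id_of_integrable_pow hmom
  obtain ⟨ψ, hψ, -⟩ := exists_contDiff_isCharExponent hdiv.charFun_ne_zero
    (contDiff_charFun' (n := ⊤) hmem)
  refine ⟨fun t => ⟨?_, fun ρ hρ => hρ.hasMaxwellBoltzmannMoments hdiv hmem⟩, ?_⟩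
  · obtain ⟨ρ, hρ⟩ := exists_charFun_eq_cexp_mul hdiv hψ t
    refine ⟨ρ, ⟨ψ, hψ, hρ⟩, ?_⟩
    rintro σ ⟨ψ', hψ', hσ⟩
    obtain rfl := hψ.unique hψ'
    refine ProbabilityMeasure.toMeasure_injective (Measure.ext_of_charFun (funext fun θ => ?_))
    rw [hσ, hρ]
  · rintro Ω _ P _ Y hY rfl t n hn
    have hprob : IsProbabilityMeasure (P.map (Y t)) :=
      Measure.isProbabilityMeasure_map (hY.measurable t).aemeasurable
    obtain ⟨hint, hval⟩ :=
      (hY.isLawAtTime hψ t).hasMaxwellBoltzmannMoments hdiv hmem n hn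
    rw [integrable_map_measure (by fun_prop) (hY.measurable t).aemeasurable] at hint
    rw [integral_map (hY.measurable t).aemeasurable (by fun_prop)] at hval
    exact ⟨hint, hval⟩
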